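/- Let $\Bbbk$ be a field of characteristic $0$; all (di)algebras are over $\Bbbk$ and need not be unital. **Dialgebras.** A dialgebra is a linear space $D$ with two bilinear operations $\vdash,\dashv$. It is a *0-dialgebra* if $(x\dashv y)\vdash z=(x\vdash y)\vdash z$ and $x\dashv(y\vdash z)=x\dashv(y\dashv z)$. It is *associative* if it is a 0-dialgebra and moreover $(x\vdash y)\vdash z=x\vdash(y\vdash z)$, $(x\dashv y)\dashv z=x\dashv(y\dashv z)$, $(x\vdash y)\dashv z=x\vdash(y\dashv z)$. If $D$ is an associative dialgebra, $D^{(+)}$ is the space $D$ with the operations $a\vdash' b=\frac12(a\vdash b+b\dashv a)$ and $a\dashv' b=\frac12(a\dashv b+b\vdash a)$. **Free objects.** Let $X=\{x_1,x_2,\dots\}$ be countable, and let $\mathrm{Alg}\langle X\rangle$ be the free nonassociative algebra. The free 0-dialgebra $\mathrm{DiAlg0}\langle X\rangle$ has as a basis the nonassociative words in $X$ with one marked letter, called the central letter, where all operation signs point to the marked letter ($u\vdash w$ has the central letter of $w$, and $w\dashv u$ has the central letter of $w$). Let $f\mapsto\bar f$ be the linear map $\mathrm{DiAlg0}\langle X\rangle\to\mathrm{Alg}\langle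 X\rangle$ that forgets the mark. For a polynomial $g\in\mathrm{Alg}\langle X\rangle$ that is a combination of words of degree $1$ in $z\in X$, let $\Psi^{z}(g)\in\mathrm{DiAlg0}\langle X\rangle$ be obtained from $g$ by marking the letter $z$ in each word. A (di)polynomial is multilinear in a finite set of variables if each of its words contains every variable of the set exactly once, and no other variable. **Varieties.** $\mathrm{Jord}$ is the class of Jordan algebras, and $\mathrm{SJ}$ is the class of special Jordan algebras, i.e. those that embed into $A^{(+)}$, with the product $\frac12(ab+ba)$, for some associative algebra $A$. $\mathrm{DiJord}$ is the class of Jordan dialgebras: the 0-dialgebras that satisfy $x_1\vdash x_2=x_2\dashv x_1$ and $\Psi^{x_i}(J)=0$ for $i=1,2,3,4$, where $$J=x_1(x_2(x_3x_4))+(x_2(x_1x_3))x_4+x_3(x_2(x_1x_4))-(x_1x_2)(x_3x_4)-(x_1x_3)(x_2x_4)-(x_3x_2)(x_1x_4).$$ $\mathrm{DiSJ}$ is the class of special Jordan dialgebras, i.e. those that embed into $D^{(+)}$ for some associative dialgebra $D$. $\mathrm{Hom}(K)$ denotes the class of homomorphic images of members of a class $K$, and $T_0(K)$ denotes the set of multilinear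 (di)polynomials, in $\mathrm{Alg}\langle X\rangle$ resp. $\mathrm{DiAlg0}\langle X\rangle$, that are identities on all members of $K$. The multilinear s-identities are $$\mathrm{SId}=T_0(\mathrm{Hom}(\mathrm{SJ}))\setminus T_0(\mathrm{Jord}),\qquad \mathrm{DiSId}=T_0(\mathrm{Hom}(\mathrm{DiSJ}))\setminus T_0(\mathrm{DiJord}).$$ **Theorem.** 1. If $g\in\mathrm{SId}$ is multilinear in the variables of a finite set $S\subset X$, then $\Psi^{z}(g)\in\mathrm{DiSId}$ for every $z\in S$. 2. If $f\in\mathrm{DiSId}$ is multilinear in the variables of a finite set $S\subset X$, then $f=\sum_{z\in S}f_z$, where $f_z$ collects the dimonomials of $f$ with central letter $z$, and there is $z\in S$ with $\bar f_z\in\mathrm{SId}$. In particular, this applies to $S=\{x_1,\dots,x_n\}$. -/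

import Mathlib

noncomputable section

namespace JordanDialg

universe u v w

/-! ### Dialgebras -/

/-- A dialgebra over `k` on the linear space `D`: two bilinear operations,
`a ⊢ b = S.vdash a b` and `a ⊣ b = S.dashv a b`. -/
structure Dialgebra (k : Type u) (D : Type v) [Field k] [AddCommGroup D] [Module k D] where
  vdash : D →ₗ[k] D →ₗ[k] D
  dashv : D →ₗ[k] D →ₗ[k] D

namespace Dialgebra

variable {k : Type u} [Field k] {D : Type v} [AddCommGroup D] [Module k D]
  {E : Type w} [AddCommGroup E] [Module k E]

/-- Homomorphisms of dialgebras. -/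
structure IsHom (S : Dialgebra k D) (T : Dialgebra k E) (φ : D →ₗ[k] E) : Prop where
  map_vdash : ∀ a b, φ (S.vdash a b) = T.vdash (φ a) (φ b)
  map_dashv : ∀ a b, φ (S.dashv a b) = T.dashv (φ a) (φ b)

/-- The 0-identities `(x ⊣ y) ⊢ z = (x ⊢ y) ⊢ z` and `x ⊣ (y ⊢ z) = x ⊣ (y ⊣ z)`. -/
structure IsZero (S : Dialgebra k D) : Prop where
  left_bar : ∀ x y z, S.vdash (S.dashv x y) z = S.vdash (S.vdash x y) z
  right_bar : ∀ x y z, S.dashv x (S.vdash y z) = S.dashv x (S.dashv y z)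

/-- Associative dialgebras. -/
structure IsAssociative (S : Dialgebra k D) : Prop extends IsZero S where
  assoc_vdash : ∀ x y z, S.vdash (S.vdash x y) z = S.vdash x (S.vdash y z)
  assoc_dashv : ∀ x y z, S.dashv (S.dashv x y) z = S.dashv x (S.dashv y z)
  assoc_inner : ∀ x y z, S.dashv (S.vdash x y) z = S.vdash x (S.dashv y z)

/-- The dialgebra `D⁽⁺⁾`: the new operations are `(a ⊢ b + b ⊣ a) / 2` and
`(a ⊣ b + b ⊢ a) / 2`. -/
def plus (S : Dialgebra k D) : Dialgebra k D where
  vdash := (2⁻¹ : k) • (S.vdash + S.dashv.flip)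
  dashv := (2⁻¹ : k) • (S.dashv + S.vdash.flip)

theorem plus_vdash (S : Dialgebra k D) (a b : D) :
    S.plus.vdash a b = (2⁻¹ : k) • (S.vdash a b + S.dashv b a) := rfl

theorem plus_dashv (S : Dialgebra k D) (a b : D) :
    S.plus.dashv a b = (2⁻¹ : k) • (S.dashv a b + S.vdash b a) := rfl

/-- The value of the word `u^⊢` (every operation of the word `u` is `⊢`) under `x ↦ a x`. -/
def evalVdash (S : Dialgebra k D) {X : Type w} (a : X → D) : FreeMagma X → D
  | .of x => a x
  | .mul u v => S.vdash (evalVdash S a u) (evalVdash S a v)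

/-- The value of the word `u^⊣` (every operation of the word `u` is `⊣`) under `x ↦ a x`. -/
def evalDashv (S : Dialgebra k D) {X : Type w} (a : X → D) : FreeMagma X → D
  | .of x => a x
  | .mul u v => S.dashv (evalDashv S a u) (evalDashv S a v)

end Dialgebra

/-! ### Words, dimonomials, free algebras -/

/-- The degree of a nonassociative word in the letter `z`. -/
def degIn {X : Type u} [DecidableEq X] (z : X) : FreeMagma X → ℕ
  | .of x => if x = z then 1 else 0
  | .mul u v => degIn z u + degIn z v

/-- The dimonomials `(a₁ … ȧ_k … a_n)` of the free 0-dialgebra: nonassociative words with one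
letter marked as central, all operations pointing to it. `right u w` is `u ⊢ w` with the central
letter in `w`, and `left w u` is `w ⊣ u` with the central letter in `w`. -/
inductive Dimonomial (X : Type u) : Type u
  | of : X → Dimonomial X
  | right : FreeMagma X → Dimonomial X → Dimonomial X
  | left : Dimonomial X → FreeMagma X → Dimonomial X

namespace Dimonomial

variable {X : Type u}

/-- The underlying nonassociative word (the mark is forgotten). -/
def word : Dimonomial X → FreeMagma X
  | .of x => .of x
  | .right u w => .mul u w.word
  | .left w u => .mul w.word u

/-- The central letter. -/
def center : Dimonomial X → X
  | .of x => x
  | .right _ w => w.center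
  | .left w _ => w.center

/-- `Ψ^z` on words: all operations point to the letter `z`. Meaningful only for words of
degree one in `z`. -/
def point [DecidableEq X] (z : X) : FreeMagma X → Dimonomial X
  | .of x => .of x
  | .mul u v => if 0 < degIn z u then .left (point z u) v else .right u (point z v)

/-- The value of a dimonomial in a dialgebra under `x ↦ a x`. -/
def eval {k : Type*} [Field k] {D : Type*} [AddCommGroup D] [Module k D] (S : Dialgebra k D)
    (a : X → D) : Dimonomial X → D
  | .of x => a x
  | .right u w => S.vdash (S.evalVdash a u) (w.eval S a)
  | .left w u => S.dashv (w.eval S a) (S.evalDashv a u)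

end Dimonomial

section Free

variable (k : Type u) [Field k] (X : Type v)

/-- The free nonassociative algebra `Alg⟨X⟩`, without unit. -/
abbrev FreeAlg := FreeNonUnitalNonAssocAlgebra k X

/-- The underlying space of the free 0-dialgebra `DiAlg0⟨X⟩`, with basis the dimonomials. -/
abbrev FreeDialg0 := Dimonomial X →₀ k

/-- The operations of the free 0-dialgebra: on dimonomials, `w₁ ⊢ w₂` keeps the central letter
of `w₂` and `w₁ ⊣ w₂` keeps the central letter of `w₁`. -/
def freeDialg0 : Dialgebra k (FreeDialg0 k X) where
  vdash := Finsupp.lift _ k _ fun w₁ => Finsupp.lift _ k _ fun w₂ =>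
    Finsupp.single (Dimonomial.right w₁.word w₂) 1
  dashv := Finsupp.lift _ k _ fun w₁ => Finsupp.lift _ k _ fun w₂ =>
    Finsupp.single (Dimonomial.left w₁ w₂.word) 1

variable {k X}

/-- The value `f(a)` of `f ∈ DiAlg0⟨X⟩` in a dialgebra under `x ↦ a x`. -/
def evalDi {D : Type*} [AddCommGroup D] [Module k D] (S : Dialgebra k D) (a : X → D) :
    FreeDialg0 k X →ₗ[k] D :=
  Finsupp.lift _ k _ fun w => w.eval S a

/-- The map `f ↦ f̄` from `DiAlg0⟨X⟩` to `Alg⟨X⟩`, which forgets the central letters. -/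
def bar : FreeDialg0 k X →ₗ[k] FreeAlg k X :=
  Finsupp.lift _ k _ fun w => MonoidAlgebra.single w.word 1

/-- The part `f_z` of `f` that consists of the dimonomials with central letter `z`. -/
def centralPart [DecidableEq X] (z : X) (f : FreeDialg0 k X) : FreeDialg0 k X :=
  f.filter fun w => w.center = z

/-- `Ψ^z : Alg⟨X⟩ → DiAlg0⟨X⟩` (meaningful on the span of the words of degree one in `z`). -/
def psi [DecidableEq X] (z : X) (g : FreeAlg k X) : FreeDialg0 k X :=
  g.coeff.mapDomain (Dimonomial.point z)

/-- The word `u` contains every letter from `s` exactly once and no other letter. -/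
def IsMultilinearWord [DecidableEq X] (s : Finset X) (u : FreeMagma X) : Prop :=
  ∀ x, degIn x u = if x ∈ s then 1 else 0

/-- The polynomial `g` is multilinear in the letters from `s`. -/
def IsMultilinear [DecidableEq X] (s : Finset X) (g : FreeAlg k X) : Prop :=
  ∀ u ∈ g.coeff.support, IsMultilinearWord s u

/-- The dipolynomial `f` is multilinear in the letters from `s`. -/
def IsMultilinearDi [DecidableEq X] (s : Finset X) (f : FreeDialg0 k X) : Prop :=
  ∀ w ∈ f.support, IsMultilinearWord s w.word

/-! `DiAlg0⟨X⟩` is the free 0-dialgebra, and `evalDi` is its universal map. -/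

theorem vdash_single (w₁ w₂ : Dimonomial X) :
    (freeDialg0 k X).vdash (Finsupp.single w₁ 1) (Finsupp.single w₂ 1) =
      Finsupp.single (.right w₁.word w₂) 1 := by
  simp [freeDialg0]

theorem dashv_single (w₁ w₂ : Dimonomial X) :
    (freeDialg0 k X).dashv (Finsupp.single w₁ 1) (Finsupp.single w₂ 1) =
      Finsupp.single (.left w₁ w₂.word) 1 := by
  simp [freeDialg0]

theorem freeDialg0_isZero : (freeDialg0 k X).IsZero := by
  have key : ∀ {F G : FreeDialg0 k X →ₗ[k] FreeDialg0 k X →ₗ[k] FreeDialg0 k X →ₗ[k]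
      FreeDialg0 k X}, (∀ w₁ w₂ w₃ : Dimonomial X,
        F (Finsupp.single w₁ 1) (Finsupp.single w₂ 1) (Finsupp.single w₃ 1) =
        G (Finsupp.single w₁ 1) (Finsupp.single w₂ 1) (Finsupp.single w₃ 1)) → F = G := by
    intro F G h
    refine Finsupp.lhom_ext' fun w₁ => LinearMap.ext_ring ?_
    refine Finsupp.lhom_ext' fun w₂ => LinearMap.ext_ring ?_
    refine Finsupp.lhom_ext' fun w₃ => LinearMap.ext_ring ?_
    exact h w₁ w₂ w₃
  constructor
  · intro x y z
    have := key (F := (freeDialg0 k X).dashv.compr₂ (freeDialg0 k X).vdash)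
      (G := (freeDialg0 k X).vdash.compr₂ (freeDialg0 k X).vdash)
      (fun w₁ w₂ w₃ => by simp [vdash_single, dashv_single, Dimonomial.word])
    exact congrArg (fun F => F x y z) this
  · intro x y z
    have := key
      (F := (freeDialg0 k X).vdash.compr₂
        ((LinearMap.id (R := k) (M := FreeDialg0 k X →ₗ[k] FreeDialg0 k X)).comp
          (LinearMap.flip (freeDialg0 k X).dashv)))
      (G := (freeDialg0 k X).dashv.compr₂
        ((LinearMap.id (R := k) (M := FreeDialg0 k X →ₗ[k] FreeDialg0 k X)).comp
          (LinearMap.flip (freeDialg0 k X).dashv)))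
      (fun w₁ w₂ w₃ => by simp [vdash_single, dashv_single, Dimonomial.word])
    exact congrArg (fun F => F y z x) this

theorem evalDi_single {D : Type*} [AddCommGroup D] [Module k D] (S : Dialgebra k D)
    (a : X → D) (w : Dimonomial X) : evalDi S a (Finsupp.single w 1) = w.eval S a := by
  simp [evalDi]

theorem evalDi_isHom {D : Type*} [AddCommGroup D] [Module k D] {S : Dialgebra k D}
    (hS : S.IsZero) (a : X → D) : (freeDialg0 k X).IsHom S (evalDi S a) := by
  -- `I` is the ideal of `D` spanned by the elements `x ⊢ y - x ⊣ y`
  let I : Submodule k D := Submodule.span k {d | ∃ x y, d = S.vdash x y - S.dashv x y}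
  have hgen : ∀ x y, S.vdash x y - S.dashv x y ∈ I := fun x y =>
    Submodule.subset_span ⟨x, y, rfl⟩
  have hv : ∀ t ∈ I, ∀ d, S.vdash t d = 0 := by
    intro t ht d
    have hle : I ≤ LinearMap.ker (S.vdash.flip d) := by
      refine Submodule.span_le.2 ?_
      rintro _ ⟨x, y, rfl⟩
      simp [hS.left_bar]
    simpa using hle ht
  have hd : ∀ t ∈ I, ∀ d, S.dashv d t = 0 := by
    intro t ht d
    have hle : I ≤ LinearMap.ker (S.dashv d) := by
      refine Submodule.span_le.2 ?_
      rintro _ ⟨x, y, rfl⟩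
      simp [hS.right_bar]
    simpa using hle ht
  have hv' : ∀ t ∈ I, ∀ d, S.vdash d t ∈ I := fun t ht d => by
    simpa [hd t ht d] using hgen d t
  have hd' : ∀ t ∈ I, ∀ d, S.dashv t d ∈ I := fun t ht d => by
    simpa [hv t ht d] using hgen t d
  have hmulv : ∀ p q p' q', p - p' ∈ I → q - q' ∈ I → S.vdash p q - S.vdash p' q' ∈ I := by
    intro p q p' q' hp hq
    have h1 : S.vdash p q - S.vdash p' q' = S.vdash (p - p') q + S.vdash p' (q - q') := by
      simp
    rw [h1, hv _ hp, zero_add]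
    exact hv' _ hq _
  have hmuld : ∀ p q p' q', p - p' ∈ I → q - q' ∈ I → S.vdash p q - S.dashv p' q' ∈ I := by
    intro p q p' q' hp hq
    have h1 : S.vdash p q - S.dashv p' q' =
        (S.vdash p q - S.vdash p' q') + (S.vdash p' q' - S.dashv p' q') := by abel
    rw [h1]
    exact I.add_mem (hmulv _ _ _ _ hp hq) (hgen _ _)
  have hu : ∀ u : FreeMagma X, S.evalVdash a u - S.evalDashv a u ∈ I := by
    intro u
    induction u using FreeMagma.rec with
    | of x => simp [Dialgebra.evalVdash, Dialgebra.evalDashv]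
    | mul u v ihu ihv => exact hmuld _ _ _ _ ihu ihv
  have hw : ∀ w : Dimonomial X, S.evalVdash a w.word - w.eval S a ∈ I := by
    intro w
    induction w with
    | of x => simp [Dimonomial.word, Dimonomial.eval, Dialgebra.evalVdash]
    | right u w ih => exact hmulv _ _ _ _ (by simp) ih
    | left w u ih => exact hmuld _ _ _ _ ih (hu u)
  have hw' : ∀ w : Dimonomial X, w.eval S a - S.evalDashv a w.word ∈ I := by
    intro w
    have h1 : w.eval S a - S.evalDashv a w.word = (S.evalVdash a w.word - S.evalDashv a w.word)
        - (S.evalVdash a w.word - w.eval S a) := by abel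
    rw [h1]
    exact I.sub_mem (hu _) (hw w)
  have ext2 : ∀ {F G : FreeDialg0 k X →ₗ[k] FreeDialg0 k X →ₗ[k] D},
      (∀ w₁ w₂ : Dimonomial X, F (Finsupp.single w₁ 1) (Finsupp.single w₂ 1) =
        G (Finsupp.single w₁ 1) (Finsupp.single w₂ 1)) → ∀ f g, F f g = G f g := by
    intro F G h f g
    have hFG : F = G := by
      refine Finsupp.lhom_ext' fun w₁ => LinearMap.ext_ring ?_
      refine Finsupp.lhom_ext' fun w₂ => LinearMap.ext_ring ?_
      exact h w₁ w₂
    rw [hFG]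
  constructor
  · refine ext2 (F := (freeDialg0 k X).vdash.compr₂ (evalDi S a))
      (G := S.vdash.compl₁₂ (evalDi S a) (evalDi S a)) fun w₁ w₂ => ?_
    simp only [LinearMap.compr₂_apply, LinearMap.compl₁₂_apply, vdash_single, evalDi_single]
    have := hv _ (hw w₁) (w₂.eval S a)
    rw [map_sub, LinearMap.sub_apply, sub_eq_zero] at this
    exact this
  · refine ext2 (F := (freeDialg0 k X).dashv.compr₂ (evalDi S a))
      (G := S.dashv.compl₁₂ (evalDi S a) (evalDi S a)) fun w₁ w₂ => ?_
    simp only [LinearMap.compr₂_apply, LinearMap.compl₁₂_apply, dashv_single, evalDi_single]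
    have := hd _ (hw' w₂) (w₁.eval S a)
    rw [map_sub, sub_eq_zero] at this
    exact this.symm

theorem evalDi_unique {D : Type*} [AddCommGroup D] [Module k D] {S : Dialgebra k D}
    (a : X → D) (hS : S.IsZero) (φ : FreeDialg0 k X →ₗ[k] D) (hφ : (freeDialg0 k X).IsHom S φ)
    (ha : ∀ x, φ (Finsupp.single (.of x) 1) = a x) : φ = evalDi S a := by
  have hword : ∀ u : FreeMagma X, ∃ w : Dimonomial X, w.word = u := by
    intro u
    induction u using FreeMagma.rec with
    | of x => exact ⟨.of x, rfl⟩
    | mul u v _ ihv =>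
      obtain ⟨w, rfl⟩ := ihv
      exact ⟨.right u w, rfl⟩
  have hlen : ∀ (n : ℕ) (w : Dimonomial X), w.word.length ≤ n →
      φ (Finsupp.single w 1) = evalDi S a (Finsupp.single w 1) := by
    have hE := evalDi_isHom (k := k) hS a
    have hpos : ∀ u : FreeMagma X, 0 < u.length := FreeMagma.length_pos
    intro n
    induction n with
    | zero => intro w hw; exact absurd (hpos w.word) (by omega)
    | succ n ih =>
      intro w hw
      cases w with
      | of x => rw [ha, evalDi_single]; rfl
      | right u w =>
        obtain ⟨w', rfl⟩ := hword u
        have h1 := hpos w'.word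
        have h2 := hpos w.word
        simp only [Dimonomial.word, FreeMagma.length] at hw
        rw [← vdash_single, hφ.map_vdash, hE.map_vdash, ih w' (by omega), ih w (by omega)]
      | left w u =>
        obtain ⟨w', rfl⟩ := hword u
        have h1 := hpos w'.word
        have h2 := hpos w.word
        simp only [Dimonomial.word, FreeMagma.length] at hw
        rw [← dashv_single, hφ.map_dashv, hE.map_dashv, ih w' (by omega), ih w (by omega)]
  refine Finsupp.lhom_ext' fun w => LinearMap.ext_ring ?_
  exact hlen _ w le_rfl

/-- `f` is the sum of its parts `f_z`, `z ∈ s`, if it is multilinear in the letters from `s`. -/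
theorem sum_centralPart [DecidableEq X] (s : Finset X) (f : FreeDialg0 k X)
    (hf : IsMultilinearDi s f) : f = ∑ z ∈ s, centralPart z f := by
  have hc : ∀ w : Dimonomial X, 0 < degIn w.center w.word := by
    intro w
    induction w with
    | of x => simp [Dimonomial.center, Dimonomial.word, degIn]
    | right u w ih => simp only [Dimonomial.center, Dimonomial.word, degIn]; omega
    | left w u ih => simp only [Dimonomial.center, Dimonomial.word, degIn]; omega
  ext w
  rw [Finsupp.finsetSum_apply]
  simp only [centralPart, Finsupp.filter_apply]
  by_cases h0 : f w = 0
  · simp [h0]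
  · have h1 := hf w (Finsupp.mem_support_iff.2 h0) w.center
    have h2 := hc w
    have h3 : w.center ∈ s := by
      by_contra h
      rw [if_neg h] at h1
      omega
    simp [h3]

end Free

/-! ### Classes of algebras, and their multilinear identities -/

section Varieties

variable (k : Type u) [Field k]

/-- Classes of (nonassociative, not necessarily unital) algebras over `k`. -/
abbrev AlgClass := ∀ (A : Type u) [NonUnitalNonAssocRing A] [Module k A] [IsScalarTower k A A]
  [SMulCommClass k A A], Prop

/-- Classes of dialgebras over `k`. -/
abbrev DialgClass := ∀ (D : Type u) [AddCommGroup D] [Module k D], Dialgebra k D → Prop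

variable {k}

/-- `Hom(K)`: the homomorphic images of the algebras from the class `K`. -/
def HomClass (K : AlgClass k) : AlgClass k := fun A _ _ _ _ =>
  ∃ (B : Type u) (_ : NonUnitalNonAssocRing B) (_ : Module k B) (_ : IsScalarTower k B B)
    (_ : SMulCommClass k B B), K B ∧ ∃ φ : B →ₙₐ[k] A, Function.Surjective φ

/-- `Hom(K)`: the homomorphic images of the dialgebras from the class `K`. -/
def HomDialgClass (K : DialgClass k) : DialgClass k := fun D _ _ S =>
  ∃ (E : Type u) (_ : AddCommGroup E) (_ : Module k E) (T : Dialgebra k E), K E T ∧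
    ∃ φ : E →ₗ[k] D, T.IsHom S φ ∧ Function.Surjective φ

/-- `T₀(K)`: the multilinear identities `g ∈ Alg⟨x₀, x₁, …⟩` of the class `K`. -/
def T0 (K : AlgClass k) : Set (FreeAlg k ℕ) :=
  {g | (∃ s, IsMultilinear s g) ∧
    ∀ (A : Type u) [NonUnitalNonAssocRing A] [Module k A] [IsScalarTower k A A]
      [SMulCommClass k A A], K A →
      ∀ a : ℕ → A, FreeNonUnitalNonAssocAlgebra.lift k a g = 0}

/-- `T₀(K)`: the multilinear identities `f ∈ DiAlg0⟨x₀, x₁, …⟩` of the class `K`. -/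
def DiT0 (K : DialgClass k) : Set (FreeDialg0 k ℕ) :=
  {f | (∃ s, IsMultilinearDi s f) ∧
    ∀ (D : Type u) [AddCommGroup D] [Module k D] (S : Dialgebra k D), K D S →
      ∀ a : ℕ → D, evalDi S a f = 0}

variable (k)

/-- The class of Jordan algebras. -/
def Jord : AlgClass k := fun A _ _ _ _ =>
  ∃ h : ∀ a b : A, a * b = b * a, @IsCommJordan A { toMul := inferInstance, mul_comm := h }

/-- The class of special Jordan algebras: those that embed into `A⁽⁺⁾` for some associative
algebra `A`. -/
def SJ : AlgClass k := fun J _ _ _ _ =>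
  ∃ (A : Type u) (_ : NonUnitalRing A) (_ : Module k A) (_ : IsScalarTower k A A)
    (_ : SMulCommClass k A A) (i : J →ₗ[k] A), Function.Injective i ∧
      ∀ a b, i (a * b) = (2⁻¹ : k) • (i a * i b + i b * i a)

/-- The Jordan identity in multilinear form, `J(x₁, x₂, x₃, x₄)`. -/
def jordanPoly : FreeAlg k (Fin 4) :=
  let x : Fin 4 → FreeAlg k (Fin 4) := FreeNonUnitalNonAssocAlgebra.of k
  x 0 * (x 1 * (x 2 * x 3)) + (x 1 * (x 0 * x 2)) * x 3 + x 2 * (x 1 * (x 0 * x 3))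
    - (x 0 * x 1) * (x 2 * x 3) - (x 0 * x 2) * (x 1 * x 3) - (x 2 * x 1) * (x 0 * x 3)

/-- The class of Jordan dialgebras: 0-dialgebras with `x₁ ⊢ x₂ = x₂ ⊣ x₁` and
`J(ẋ₁, x₂, x₃, x₄) = J(x₁, ẋ₂, x₃, x₄) = J(x₁, x₂, ẋ₃, x₄) = J(x₁, x₂, x₃, ẋ₄) = 0`. -/
def DiJord : DialgClass k := fun D _ _ S =>
  S.IsZero ∧ (∀ x y, S.vdash x y = S.dashv y x) ∧
    ∀ (i : Fin 4) (a : Fin 4 → D), evalDi S a (psi i (jordanPoly k)) = 0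

/-- The class of special Jordan dialgebras: those that embed into `D⁽⁺⁾` for some associative
dialgebra `D`. -/
def DiSJ : DialgClass k := fun J _ _ S =>
  ∃ (D : Type u) (_ : AddCommGroup D) (_ : Module k D) (T : Dialgebra k D),
    T.IsAssociative ∧ ∃ i : J →ₗ[k] D, S.IsHom T.plus i ∧ Function.Injective i

/-- Multilinear s-identities of Jordan algebras. -/
def SId : Set (FreeAlg k ℕ) := T0 (HomClass (SJ k)) \ T0 (Jord k)

/-- Multilinear s-identities of Jordan dialgebras. -/
def DiSId : Set (FreeDialg0 k ℕ) := DiT0 (HomDialgClass (DiSJ k)) \ DiT0 (DiJord k)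

end Varieties

end JordanDialg

end

/-!
Identities pass to homomorphic images, so `Hom` plays no role: it suffices to compare identities of
special Jordan algebras and dialgebras, and identities of Jordan algebras and dialgebras.

From algebras to dialgebras: a 0-dialgebra `D` has the ideal spanned by the elements
`x ⊢ y - x ⊣ y`; modulo it the operations coincide and give an algebra `D̄`, which acts on `D` from
the left by `⊢` and from the right by `⊣`. In the split null extension `E = D̄ ⊕ D` the value of a
polynomial `g`, multilinear in a set of letters containing `z`, with `z` taken in `D` and the other
letters in `D̄`, is the value of `Ψ^z(g)` in the dialgebra `D` (`IsSplitRep.lift_eq`). If `D` is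
associative, then so is `E`, and the special Jordan algebra `E⁽⁺⁾` plays the same role for `D⁽⁺⁾`
(`IsSplitRep.plus`). If `D` is a Jordan dialgebra, then `E` is a Jordan algebra
(`DiJord.jord_splitNull`). So `Ψ^z` sends identities of special Jordan algebras to identities of
special Jordan dialgebras, and identities of Jordan algebras to identities of Jordan dialgebras.

From dialgebras to algebras: a Jordan algebra is a Jordan dialgebra with both operations equal to
the product, and there `Ψ^z(g)` and `g` have the same values; so `Ψ^z(g)` is an identity of Jordan
dialgebras only if `g` is one of Jordan algebras. For a special Jordan algebra `J` the dialgebra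
`J ⊕ J`, whose second component follows the central factor, is special, and evaluating only `z` with
a nonzero second component isolates `f̄_z` (`evalDi_double`); so every `f̄_z` is an identity of
special Jordan algebras if `f` is one of special Jordan dialgebras.

This gives the first assertion. For the second one, if no `f̄_z` were an s-identity, all of them
would be identities of Jordan algebras, and `f`, the sum of the `f_z = Ψ^z(f̄_z)`, would be an
identity of Jordan dialgebras.
-/

noncomputable section

namespace JordanDialg

universe u v w

/-! ### Evaluation of words and polynomials -/

section Evaluation

variable {k : Type u} [Field k] {X : Type v}

/-- The value of a polynomial is the corresponding combination of the values of its words. -/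
theorem lift_eq_sum {A : Type*} [NonUnitalNonAssocRing A] [Module k A] [IsScalarTower k A A]
    [SMulCommClass k A A] (a : X → A) (g : FreeAlg k X) :
    FreeNonUnitalNonAssocAlgebra.lift k a g =
      g.coeff.sum fun u c => c • FreeMagma.lift a u := by
  simp only [FreeNonUnitalNonAssocAlgebra.lift, Equiv.trans_apply,
    MonoidAlgebra.liftMagma_apply_apply]
  rfl

variable {D : Type*} [AddCommGroup D] [Module k D] {E : Type*} [AddCommGroup E] [Module k E]

theorem evalDi_psi [DecidableEq X] (S : Dialgebra k D) (a : X → D) (z : X) (g : FreeAlg k X) :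
    evalDi S a (psi z g) = g.coeff.sum fun u c => c • (Dimonomial.point z u).eval S a := by
  rw [psi, evalDi, Finsupp.lift_apply, Finsupp.sum_mapDomain_index] <;> simp [add_smul]

theorem lift_bar {A : Type*} [NonUnitalNonAssocRing A] [Module k A] [IsScalarTower k A A]
    [SMulCommClass k A A] (a : X → A) (w : Dimonomial X) (c : k) :
    FreeNonUnitalNonAssocAlgebra.lift k a (bar (Finsupp.single w c)) =
      c • FreeMagma.lift a w.word := by
  simp [lift_eq_sum, bar]

theorem map_lift {A B : Type*} [NonUnitalNonAssocRing A] [Module k A] [IsScalarTower k A A]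
    [SMulCommClass k A A] [NonUnitalNonAssocRing B] [Module k B] [IsScalarTower k B B]
    [SMulCommClass k B B] (φ : A →ₙₐ[k] B) (a : X → A) (g : FreeAlg k X) :
    φ (FreeNonUnitalNonAssocAlgebra.lift k a g) =
      FreeNonUnitalNonAssocAlgebra.lift k (φ ∘ a) g := by
  have h : φ.comp (FreeNonUnitalNonAssocAlgebra.lift k a) =
      FreeNonUnitalNonAssocAlgebra.lift k (φ ∘ a) :=
    FreeNonUnitalNonAssocAlgebra.hom_ext k fun x => by simp
  exact DFunLike.congr_fun h g

namespace Dialgebra.IsHom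

variable {S : Dialgebra k D} {T : Dialgebra k E} {φ : D →ₗ[k] E}

theorem map_evalVdash (h : S.IsHom T φ) (a : X → D) (u : FreeMagma X) :
    φ (S.evalVdash a u) = T.evalVdash (φ ∘ a) u := by
  induction u using FreeMagma.rec with
  | of x => rfl
  | mul u v ihu ihv => simp only [evalVdash, h.map_vdash, ihu, ihv]

theorem map_evalDashv (h : S.IsHom T φ) (a : X → D) (u : FreeMagma X) :
    φ (S.evalDashv a u) = T.evalDashv (φ ∘ a) u := by
  induction u using FreeMagma.rec with
  | of x => rfl
  | mul u v ihu ihv => simp only [evalDashv, h.map_dashv, ihu, ihv]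

theorem map_eval (h : S.IsHom T φ) (a : X → D) (w : Dimonomial X) :
    φ (w.eval S a) = w.eval T (φ ∘ a) := by
  induction w with
  | of x => rfl
  | right u w ih => simp only [Dimonomial.eval, h.map_vdash, h.map_evalVdash, ih]
  | left w u ih => simp only [Dimonomial.eval, h.map_dashv, h.map_evalDashv, ih]

theorem map_evalDi (h : S.IsHom T φ) (a : X → D) (f : FreeDialg0 k X) :
    φ (evalDi S a f) = evalDi T (φ ∘ a) f := by
  simp [evalDi, Finsupp.lift_apply, map_finsuppSum, h.map_eval]

end Dialgebra.IsHom

end Evaluation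

/-! ### Multilinearity, marking and forgetting -/

section Multilinear

variable {k : Type u} [Field k] {X : Type v} [DecidableEq X]

theorem Dimonomial.word_point (z : X) (u : FreeMagma X) : (point z u).word = u := by
  induction u using FreeMagma.rec with
  | of x => rfl
  | mul u v ihu ihv => by_cases h : 0 < degIn z u <;> simp [point, word, h, ihu, ihv]

theorem degIn_center_pos (w : Dimonomial X) : 0 < degIn w.center w.word := by
  induction w with
  | of x => simp [Dimonomial.center, Dimonomial.word, degIn]
  | right u w ih => simp only [Dimonomial.center, Dimonomial.word, degIn]; omega
  | left w u ih => simp only [Dimonomial.center, Dimonomial.word, degIn]; omega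

theorem Dimonomial.point_word {z : X} (w : Dimonomial X) (hc : w.center = z)
    (hd : degIn z w.word = 1) : point z w.word = w := by
  induction w with
  | of x => rfl
  | right u w ih =>
    have hp := degIn_center_pos w
    simp only [center] at hc
    simp only [word, degIn] at hd
    rw [hc] at hp
    simp only [word, point]
    rw [if_neg (by omega), ih hc (by omega)]
  | left w u ih =>
    have hp := degIn_center_pos w
    simp only [center] at hc
    simp only [word, degIn] at hd
    rw [hc] at hp
    simp only [word, point]
    rw [if_pos hp, ih hc (by omega)]

theorem IsMultilinear.psi {s : Finset X} {g : FreeAlg k X} (hg : IsMultilinear s g) (z : X) :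
    IsMultilinearDi s (psi z g) := by
  intro w hw
  classical
  obtain ⟨u, hu, rfl⟩ := Finset.mem_image.1 (Finsupp.mapDomain_support hw)
  rw [Dimonomial.word_point]
  exact hg u hu

theorem IsMultilinearDi.centralPart {s : Finset X} {f : FreeDialg0 k X}
    (hf : IsMultilinearDi s f) (z : X) : IsMultilinearDi s (centralPart z f) := by
  intro w hw
  rw [JordanDialg.centralPart, Finsupp.support_filter] at hw
  exact hf w (Finset.mem_filter.1 hw).1

omit [DecidableEq X] in
theorem coeff_bar (f : FreeDialg0 k X) : (bar f).coeff = f.mapDomain Dimonomial.word := by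
  induction f using Finsupp.induction_linear with
  | zero => simp
  | add f g hf hg => simp [hf, hg, Finsupp.mapDomain_add]
  | single w c => simp [bar, Finsupp.mapDomain_single]

theorem IsMultilinearDi.bar {s : Finset X} {f : FreeDialg0 k X}
    (hf : IsMultilinearDi s f) : IsMultilinear s (bar f) := by
  intro u hu
  rw [coeff_bar] at hu
  classical
  obtain ⟨w, hw, rfl⟩ := Finset.mem_image.1 (Finsupp.mapDomain_support hu)
  exact hf w hw

theorem psi_bar_centralPart {s : Finset X} {f : FreeDialg0 k X} (hf : IsMultilinearDi s f)
    {z : X} (hz : z ∈ s) : psi z (bar (centralPart z f)) = centralPart z f := by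
  rw [psi, coeff_bar, ← Finsupp.mapDomain_comp]
  refine (Finsupp.mapDomain_congr (g := id) fun w hw => ?_).trans Finsupp.mapDomain_id
  have hd := hf.centralPart z w hw z
  rw [if_pos hz] at hd
  rw [centralPart, Finsupp.support_filter] at hw
  exact w.point_word (Finset.mem_filter.1 hw).2 hd

end Multilinear

/-! ### Algebras given by a bilinear product -/

section MulOn

variable {k : Type u} [Field k] {V : Type v} [AddCommGroup V] [Module k V]

/-- The space `V` as an algebra with the bilinear product `μ`. -/
def MulOn (_μ : V →ₗ[k] V →ₗ[k] V) : Type v := V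

namespace MulOn

variable (μ : V →ₗ[k] V →ₗ[k] V)

instance : AddCommGroup (MulOn μ) := inferInstanceAs (AddCommGroup V)

instance : Module k (MulOn μ) := inferInstanceAs (Module k V)

instance : Mul (MulOn μ) := ⟨fun a b => (μ : V →ₗ[k] V →ₗ[k] V) a b⟩

instance : NonUnitalNonAssocRing (MulOn μ) where
  left_distrib a b c := map_add (μ a) b c
  right_distrib a b c := LinearMap.map_add₂ μ a b c
  zero_mul a := LinearMap.map_zero₂ μ a
  mul_zero a := map_zero (μ a)

instance : IsScalarTower k (MulOn μ) (MulOn μ) := ⟨fun c a b => LinearMap.map_smul₂ μ c a b⟩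

instance : SMulCommClass k (MulOn μ) (MulOn μ) := ⟨fun c a b => (map_smul (μ a) c b).symm⟩

/-- The identity map from `V` to the algebra on `V`. -/
def of : V ≃ₗ[k] MulOn μ := LinearEquiv.refl k V

theorem of_mul_of (a b : V) : of μ a * of μ b = of μ (μ a b) := rfl

end MulOn

/-- The algebra `B⁽⁺⁾` with the product `(a b + b a) / 2`. -/
abbrev Plus (k : Type u) [Field k] (B : Type v) [NonUnitalNonAssocRing B] [Module k B]
    [IsScalarTower k B B] [SMulCommClass k B B] : Type v :=
  MulOn ((2⁻¹ : k) • (LinearMap.mul k B + (LinearMap.mul k B).flip))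

/-- The identity map from `B` to `B⁽⁺⁾`. -/
abbrev Plus.of (k : Type u) [Field k] (B : Type v) [NonUnitalNonAssocRing B] [Module k B]
    [IsScalarTower k B B] [SMulCommClass k B B] : B ≃ₗ[k] Plus k B := MulOn.of _

theorem Plus.of_mul_of {k : Type u} [Field k] {B : Type v} [NonUnitalNonAssocRing B] [Module k B]
    [IsScalarTower k B B] [SMulCommClass k B B] (a b : B) :
    Plus.of k B a * Plus.of k B b = Plus.of k B ((2⁻¹ : k) • (a * b + b * a)) := rfl

theorem sj_plus {k B : Type u} [Field k] [NonUnitalRing B] [Module k B]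
    [IsScalarTower k B B] [SMulCommClass k B B] : SJ k (Plus k B) :=
  ⟨B, inferInstance, inferInstance, inferInstance, inferInstance,
    (Plus.of k B).symm.toLinearMap, (Plus.of k B).symm.injective, fun _ _ => rfl⟩

end MulOn

/-! ### Representing a dialgebra in an algebra -/

section Rep

variable {k : Type u} [Field k] {D : Type v} [AddCommGroup D] [Module k D]
  {B : Type w} [NonUnitalNonAssocRing B] [Module k B]

/-- Two maps of a dialgebra into an algebra: `π` sends both operations to the product, while `ι`
turns the operations of an element on its central factor into multiplication by its `π`-image. -/
structure IsSplitRep (S : Dialgebra k D) (π ι : D →ₗ[k] B) : Prop where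
  map_vdash : ∀ x y, π (S.vdash x y) = π x * π y
  map_dashv : ∀ x y, π (S.dashv x y) = π x * π y
  mul_left : ∀ x m, π x * ι m = ι (S.vdash x m)
  mul_right : ∀ x m, ι m * π x = ι (S.dashv m x)

namespace IsSplitRep

variable {S : Dialgebra k D} {π ι : D →ₗ[k] B} (h : IsSplitRep S π ι)
  {X : Type*} [DecidableEq X] (a : X → D) (z : X)

include h

/-- Without the letter `z` a word takes its value in the image of `π`, whichever way its operations
point. -/
theorem lift_of_degIn_eq_zero {u : FreeMagma X} (hu : degIn z u = 0) :
    FreeMagma.lift (Function.update (π ∘ a) z (ι (a z))) u = π (S.evalVdash a u) ∧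
    FreeMagma.lift (Function.update (π ∘ a) z (ι (a z))) u = π (S.evalDashv a u) := by
  induction u using FreeMagma.rec with
  | of x =>
    have hx : x ≠ z := fun hx => by simp [degIn, hx] at hu
    simp [Dialgebra.evalVdash, Dialgebra.evalDashv, hx]
  | mul u v ihu ihv =>
    simp only [degIn, Nat.add_eq_zero_iff] at hu
    simp only [FreeMagma.mul_eq, map_mul]
    constructor
    · rw [(ihu hu.1).1, (ihv hu.2).1, ← h.map_vdash]; rfl
    · rw [(ihu hu.1).2, (ihv hu.2).2, ← h.map_dashv]; rfl

theorem lift_of_degIn_eq_one {u : FreeMagma X} (hu : degIn z u = 1) :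
    FreeMagma.lift (Function.update (π ∘ a) z (ι (a z))) u =
      ι ((Dimonomial.point z u).eval S a) := by
  induction u using FreeMagma.rec with
  | of x =>
    have hx : x = z := by
      by_contra hx
      simp [degIn, hx] at hu
    subst hx
    simp [Dimonomial.point, Dimonomial.eval]
  | mul u v ihu ihv =>
    simp only [degIn] at hu
    simp only [FreeMagma.mul_eq, map_mul]
    by_cases h0 : 0 < degIn z u
    · rw [ihu (by omega), (h.lift_of_degIn_eq_zero a z (u := v) (by omega)).2, h.mul_right,
        ← FreeMagma.mul_eq, Dimonomial.point, if_pos h0, Dimonomial.eval]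
    · rw [ihv (by omega), (h.lift_of_degIn_eq_zero a z (u := u) (by omega)).1, h.mul_left,
        ← FreeMagma.mul_eq, Dimonomial.point, if_neg h0, Dimonomial.eval]

/-- Marking the letter `z` in a multilinear polynomial amounts to evaluating `z` through `ι` and
the other letters through `π`. -/
theorem lift_eq [IsScalarTower k B B] [SMulCommClass k B B] {s : Finset X} (hz : z ∈ s)
    {g : FreeAlg k X} (hg : IsMultilinear s g) :
    FreeNonUnitalNonAssocAlgebra.lift k (Function.update (π ∘ a) z (ι (a z))) g =
      ι (evalDi S a (psi z g)) := by
  rw [lift_eq_sum, evalDi_psi, map_finsuppSum]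
  refine Finsupp.sum_congr fun u hu => ?_
  rw [map_smul, h.lift_of_degIn_eq_one a z ((hg u hu z).trans (if_pos hz))]

theorem plus [IsScalarTower k B B] [SMulCommClass k B B] :
    IsSplitRep S.plus ((Plus.of k B).toLinearMap ∘ₗ π) ((Plus.of k B).toLinearMap ∘ₗ ι) where
  map_vdash x y := by
    simp [Plus.of_mul_of, Dialgebra.plus_vdash, h.map_vdash, h.map_dashv]
  map_dashv x y := by
    simp [Plus.of_mul_of, Dialgebra.plus_dashv, h.map_vdash, h.map_dashv]
  mul_left x m := by
    simp [Plus.of_mul_of, Dialgebra.plus_vdash, h.mul_left, h.mul_right]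
  mul_right x m := by
    simp [Plus.of_mul_of, Dialgebra.plus_dashv, h.mul_left, h.mul_right]

end IsSplitRep

end Rep

/-! ### The split null extension of a 0-dialgebra -/

section SplitNull

variable {k : Type u} [Field k] {D : Type v} [AddCommGroup D] [Module k D]

namespace Dialgebra

/-- The span of the elements `x ⊢ y - x ⊣ y`: the least ideal modulo which the two operations of
the dialgebra coincide. -/
def barIdeal (S : Dialgebra k D) : Submodule k D :=
  Submodule.span k {d | ∃ x y, d = S.vdash x y - S.dashv x y}

theorem sub_mem_barIdeal (S : Dialgebra k D) (x y : D) :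
    S.vdash x y - S.dashv x y ∈ S.barIdeal :=
  Submodule.subset_span ⟨x, y, rfl⟩

namespace IsZero

variable {S : Dialgebra k D} (hS : S.IsZero)

include hS

theorem barIdeal_le_ker_vdash : S.barIdeal ≤ LinearMap.ker S.vdash := by
  refine Submodule.span_le.2 ?_
  rintro _ ⟨x, y, rfl⟩
  ext z
  simp [hS.left_bar]

theorem barIdeal_le_ker_dashv_flip : S.barIdeal ≤ LinearMap.ker S.dashv.flip := by
  refine Submodule.span_le.2 ?_
  rintro _ ⟨x, y, rfl⟩
  ext z
  simp [hS.right_bar]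

theorem vdash_mem_barIdeal {t : D} (ht : t ∈ S.barIdeal) (d : D) : S.vdash d t ∈ S.barIdeal := by
  have h0 : S.dashv d t = 0 := LinearMap.congr_fun (hS.barIdeal_le_ker_dashv_flip ht) d
  simpa [h0] using S.sub_mem_barIdeal d t

end IsZero

/-- The product on the quotient of a 0-dialgebra by its bar ideal. -/
def quotMul (S : Dialgebra k D) (hS : S.IsZero) :
    (D ⧸ S.barIdeal) →ₗ[k] (D ⧸ S.barIdeal) →ₗ[k] (D ⧸ S.barIdeal) :=
  S.barIdeal.liftQ
    (S.barIdeal.liftQ (S.vdash.compr₂ S.barIdeal.mkQ).flip (by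
      intro t ht
      ext d
      exact (Submodule.Quotient.mk_eq_zero _).2 (hS.vdash_mem_barIdeal ht d))).flip
    (by
      intro t ht
      ext d
      exact congrArg S.barIdeal.mkQ (LinearMap.congr_fun (hS.barIdeal_le_ker_vdash ht) d))

/-- The quotient of a 0-dialgebra by its bar ideal acts on the dialgebra from the left by `⊢`. -/
def leftAct (S : Dialgebra k D) (hS : S.IsZero) : (D ⧸ S.barIdeal) →ₗ[k] D →ₗ[k] D :=
  S.barIdeal.liftQ S.vdash hS.barIdeal_le_ker_vdash

/-- The quotient of a 0-dialgebra by its bar ideal acts on the dialgebra from the right by `⊣`;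
`rightAct x m` is `m ⊣ x`. -/
def rightAct (S : Dialgebra k D) (hS : S.IsZero) : (D ⧸ S.barIdeal) →ₗ[k] D →ₗ[k] D :=
  S.barIdeal.liftQ S.dashv.flip hS.barIdeal_le_ker_dashv_flip

/-- The product `(x, m) (y, n) = (x y, x ⊢ n + m ⊣ y)` of the split null extension. -/
def splitMul (S : Dialgebra k D) (hS : S.IsZero) :
    ((D ⧸ S.barIdeal) × D) →ₗ[k] ((D ⧸ S.barIdeal) × D) →ₗ[k] ((D ⧸ S.barIdeal) × D) :=
  LinearMap.mk₂ k
    (fun p q => (S.quotMul hS p.1 q.1, S.leftAct hS p.1 q.2 + S.rightAct hS q.1 p.2))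
    (fun p p' q => by ext <;> simp; abel)
    (fun c p q => by ext <;> simp)
    (fun p q q' => by ext <;> simp; abel)
    (fun c p q => by ext <;> simp)

/-- The split null extension of a 0-dialgebra `D`: the algebra `D̄ ⊕ D`, where `D̄` is the quotient
of `D` by its bar ideal, `D` is a `D̄`-bimodule through `⊢` and `⊣`, and `D · D = 0`. -/
abbrev SplitNull (S : Dialgebra k D) (hS : S.IsZero) : Type v := MulOn (S.splitMul hS)

namespace SplitNull

variable (S : Dialgebra k D) (hS : S.IsZero)

/-- The map `x ↦ (x̄, 0)` to the split null extension. -/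
def base : D →ₗ[k] SplitNull S hS :=
  (MulOn.of (S.splitMul hS)).toLinearMap ∘ₗ LinearMap.inl k _ _ ∘ₗ S.barIdeal.mkQ

/-- The map `m ↦ (0, m)` to the split null extension. -/
def fiber : D →ₗ[k] SplitNull S hS :=
  (MulOn.of (S.splitMul hS)).toLinearMap ∘ₗ LinearMap.inr k _ _

theorem fiber_injective : Function.Injective (fiber S hS) := LinearMap.inr_injective

theorem exists_base_add_fiber (p : SplitNull S hS) : ∃ x m, p = base S hS x + fiber S hS m := by
  obtain ⟨x, hx⟩ := S.barIdeal.mkQ_surjective ((MulOn.of (S.splitMul hS)).symm p).1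
  refine ⟨x, ((MulOn.of (S.splitMul hS)).symm p).2, ?_⟩
  apply (MulOn.of (S.splitMul hS)).symm.injective
  ext
  · simp [base, fiber, ← hx]
  · simp [base, fiber]

theorem splitMul_mk (x y m n : D) :
    S.splitMul hS (S.barIdeal.mkQ x, m) (S.barIdeal.mkQ y, n) =
      (S.barIdeal.mkQ (S.vdash x y), S.vdash x n + S.dashv m y) := rfl

theorem base_mul_base (x y : D) :
    base S hS x * base S hS y = base S hS (S.vdash x y) := by
  refine congrArg (MulOn.of (S.splitMul hS)) ((splitMul_mk S hS x y 0 0).trans ?_)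
  simp only [map_zero, add_zero, LinearMap.zero_apply]
  rfl

theorem base_mul_fiber (x m : D) :
    base S hS x * fiber S hS m = fiber S hS (S.vdash x m) := by
  refine congrArg (MulOn.of (S.splitMul hS)) ((splitMul_mk S hS x 0 0 m).trans ?_)
  simp only [map_zero, add_zero]
  rfl

theorem fiber_mul_base (m x : D) :
    fiber S hS m * base S hS x = fiber S hS (S.dashv m x) := by
  refine congrArg (MulOn.of (S.splitMul hS)) ((splitMul_mk S hS 0 x m 0).trans ?_)
  simp only [map_zero, zero_add, LinearMap.zero_apply]
  rfl

theorem fiber_mul_fiber (m n : D) : fiber S hS m * fiber S hS n = 0 := by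
  refine congrArg (MulOn.of (S.splitMul hS)) ((splitMul_mk S hS 0 0 m n).trans ?_)
  simp

theorem base_vdash_eq_dashv (x y : D) : base S hS (S.vdash x y) = base S hS (S.dashv x y) := by
  have h : S.barIdeal.mkQ (S.vdash x y) = S.barIdeal.mkQ (S.dashv x y) :=
    (Submodule.Quotient.eq _).2 (S.sub_mem_barIdeal x y)
  simp only [base, LinearMap.comp_apply, h]

theorem isSplitRep : IsSplitRep S (base S hS) (fiber S hS) where
  map_vdash x y := (base_mul_base S hS x y).symm
  map_dashv x y := by rw [← base_vdash_eq_dashv, base_mul_base]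
  mul_left := base_mul_fiber S hS
  mul_right x m := fiber_mul_base S hS m x

variable {S}

/-- The split null extension of an associative dialgebra is associative. -/
abbrev nonUnitalRing (h : S.IsAssociative) : NonUnitalRing (SplitNull S h.toIsZero) where
  mul_assoc p q r := by
    obtain ⟨x, m, rfl⟩ := exists_base_add_fiber S h.toIsZero p
    obtain ⟨y, n, rfl⟩ := exists_base_add_fiber S h.toIsZero q
    obtain ⟨z, l, rfl⟩ := exists_base_add_fiber S h.toIsZero r
    simp only [mul_add, add_mul, base_mul_base, base_mul_fiber, fiber_mul_base, fiber_mul_fiber,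
      h.assoc_vdash, h.assoc_dashv, h.assoc_inner, h.right_bar, add_zero]

end SplitNull

end Dialgebra

end SplitNull

/-! ### Jordan algebras and Jordan dialgebras -/

section Jordan

theorem psi_add {k : Type u} [Field k] {X : Type v} [DecidableEq X] (z : X) (f g : FreeAlg k X) :
    psi z (f + g) = psi z f + psi z g :=
  map_add (Finsupp.lmapDomain k k (Dimonomial.point z)) f.coeff g.coeff

theorem psi_sub {k : Type u} [Field k] {X : Type v} [DecidableEq X] (z : X) (f g : FreeAlg k X) :
    psi z (f - g) = psi z f - psi z g :=
  map_sub (Finsupp.lmapDomain k k (Dimonomial.point z)) f.coeff g.coeff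

theorem psi_single {k : Type u} [Field k] {X : Type v} [DecidableEq X] (z : X) (u : FreeMagma X) :
    psi z (MonoidAlgebra.single u 1 : FreeAlg k X) = Finsupp.single (Dimonomial.point z u) 1 :=
  Finsupp.mapDomain_single

theorem jordanPoly_eq (k : Type u) [Field k] :
    jordanPoly k =
      let x : Fin 4 → FreeMagma (Fin 4) := FreeMagma.of
      MonoidAlgebra.single (x 0 * (x 1 * (x 2 * x 3))) 1
        + MonoidAlgebra.single ((x 1 * (x 0 * x 2)) * x 3) 1
        + MonoidAlgebra.single (x 2 * (x 1 * (x 0 * x 3))) 1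
        - MonoidAlgebra.single ((x 0 * x 1) * (x 2 * x 3)) 1
        - MonoidAlgebra.single ((x 0 * x 2) * (x 1 * x 3)) 1
        - MonoidAlgebra.single ((x 2 * x 1) * (x 0 * x 3)) 1 := by
  simp [jordanPoly, FreeNonUnitalNonAssocAlgebra.of, MonoidAlgebra.single_mul_single]

variable {k : Type u} [Field k]

theorem linearized_jordan {A : Type*} [NonUnitalNonAssocCommRing A] [IsCommJordan A]
    (a b c d : A) :
    2 • ((a * ((c * d) * b) - (c * d) * (a * b)) + (c * ((d * a) * b) - (d * a) * (c * b)) +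
      (d * ((a * c) * b) - (a * c) * (d * b))) = 0 :=
  DFunLike.congr_fun (two_nsmul_lie_lmul_lmul_add_add_eq_zero a c d) b

theorem lift_jordanPoly_eq_zero [CharZero k] {A : Type u} [NonUnitalNonAssocRing A] [Module k A]
    [IsScalarTower k A A] [SMulCommClass k A A] (hA : Jord k A) (a : Fin 4 → A) :
    FreeNonUnitalNonAssocAlgebra.lift k a (jordanPoly k) = 0 := by
  obtain ⟨hc, hJ⟩ := hA
  have key := @linearized_jordan A { ‹NonUnitalNonAssocRing A› with mul_comm := hc } hJ
    (a 0) (a 1) (a 2) (a 3)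
  rw [← Nat.cast_smul_eq_nsmul k, smul_eq_zero_iff_right (by norm_num)] at key
  simp only [jordanPoly, map_sub, map_add, map_mul, FreeNonUnitalNonAssocAlgebra.lift_of_apply]
  rw [← key, hc (a 1) (a 2 * a 3), hc (a 1) (a 0 * a 2), hc (a 0 * a 2 * a 1), hc (a 1) (a 0 * a 3),
    hc (a 0 * a 1), hc (a 2 * a 1), hc (a 1) (a 3), hc (a 0) (a 3)]
  abel

open Dialgebra Dialgebra.SplitNull in
/-- In the split null extension of a Jordan dialgebra the `D̄`-part of the Jordan identity is the
image of any one of the marked Jordan identities, and its `D`-part is the sum of all four. -/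
theorem DiJord.jord_splitNull [CharZero k] {D : Type u} [AddCommGroup D] [Module k D]
    {S : Dialgebra k D} (hS : DiJord k D S) : Jord k (SplitNull S hS.1) := by
  obtain ⟨h0, hc, hJ⟩ := hS
  have hbase : ∀ x y, base S h0 (S.vdash x y) = base S h0 (S.vdash y x) := fun x y => by
    rw [base_vdash_eq_dashv, ← hc]
  have hcomm : ∀ p q : SplitNull S h0, p * q = q * p := by
    intro p q
    obtain ⟨x, m, rfl⟩ := exists_base_add_fiber S h0 p
    obtain ⟨y, n, rfl⟩ := exists_base_add_fiber S h0 q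
    simp only [mul_add, add_mul, base_mul_base, base_mul_fiber, fiber_mul_base, fiber_mul_fiber,
      ← hc, hbase x y]
    abel
  refine ⟨hcomm, @IsCommJordan.mk _ (_) fun p q => ?_⟩
  change p * q * (p * p) = p * (q * (p * p))
  obtain ⟨x, m, rfl⟩ := exists_base_add_fiber S h0 p
  obtain ⟨y, n, rfl⟩ := exists_base_add_fiber S h0 q
  -- the factor that acts may be commuted: `⊢` sees it only modulo the bar ideal
  have hsymm : ∀ x y z, S.vdash (S.vdash x y) z = S.vdash (S.vdash y x) z := fun x y z => by
    rw [← h0.left_bar, ← hc]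
  -- with `x₁ = x₃ = x₄`, the linearized identity is three times the Jordan identity
  have h1 := hJ 0 ![m, y, x, x]
  have h2 := hJ 1 ![x, n, x, x]
  have h3 := hJ 2 ![x, y, m, x]
  have h4 := hJ 3 ![x, y, x, m]
  have h5 := hJ 1 ![x, y, x, x]
  simp [jordanPoly_eq, psi_add, psi_sub, psi_single, ← FreeMagma.mul_eq, evalDi_single,
    Dimonomial.point, degIn, Dimonomial.eval, Dialgebra.evalVdash, Dialgebra.evalDashv, ← hc]
    at h1 h2 h3 h4 h5
  have hb : base S h0 (S.vdash (S.vdash x y) (S.vdash x x)) =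
      base S h0 (S.vdash x (S.vdash y (S.vdash x x))) := by
    have h6 := congrArg (base S h0) h5
    simp only [map_add, map_sub, map_zero, ← base_mul_base] at h6 ⊢
    rw [hcomm (base S h0 x * base S h0 x) (base S h0 y),
      hcomm (base S h0 x * base S h0 x) (base S h0 x * base S h0 y)] at h6
    linear_combination (norm := module) (-(3⁻¹ : k)) • h6
  simp only [mul_add, add_mul, base_mul_base, base_mul_fiber, fiber_mul_base, fiber_mul_fiber,
      ← hc, hb, add_zero, ← map_add, add_assoc]
  congr 2
  rw [hsymm (S.vdash x x) y] at h1 h3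
  simp only [map_add]
  linear_combination (norm := module) (-(3⁻¹ : k)) • (h1 + h2 + h3 + h4)

end Jordan

/-! ### Dialgebras built from an algebra -/

section FromAlgebra

variable (k : Type u) [Field k] (A : Type v) [NonUnitalNonAssocRing A] [Module k A]
  [IsScalarTower k A A] [SMulCommClass k A A]

/-- An algebra as a dialgebra whose two operations both are the product. -/
def ofAlgebra : Dialgebra k A where
  vdash := LinearMap.mul k A
  dashv := LinearMap.mul k A

/-- The dialgebra `A ⊕ A` with `(a, b) ⊢ (a', b') = (a a', a b')` and
`(a, b) ⊣ (a', b') = (a a', b a')`: the second component records the central factor. -/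
def double : Dialgebra k (A × A) where
  vdash := LinearMap.mk₂ k (fun p q => (p.1 * q.1, p.1 * q.2))
    (fun p p' q => by simp [add_mul]) (fun c p q => by simp [smul_mul_assoc])
    (fun p q q' => by simp [mul_add]) (fun c p q => by simp [mul_smul_comm])
  dashv := LinearMap.mk₂ k (fun p q => (p.1 * q.1, p.2 * q.1))
    (fun p p' q => by simp [add_mul]) (fun c p q => by simp [smul_mul_assoc])
    (fun p q q' => by simp [mul_add]) (fun c p q => by simp [mul_smul_comm])

variable {A}

theorem double_vdash (p q : A × A) : (double k A).vdash p q = (p.1 * q.1, p.1 * q.2) := rfl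

theorem double_dashv (p q : A × A) : (double k A).dashv p q = (p.1 * q.1, p.2 * q.1) := rfl

theorem ofAlgebra_eval {X : Type w} (a : X → A) (w : Dimonomial X) :
    w.eval (ofAlgebra k A) a = FreeMagma.lift a w.word := by
  have hv : ∀ u : FreeMagma X, (ofAlgebra k A).evalVdash a u = FreeMagma.lift a u := by
    intro u
    induction u using FreeMagma.rec with
    | of x => rfl
    | mul u v ihu ihv => simp only [Dialgebra.evalVdash, ihu, ihv]; rfl
  have hd : ∀ u : FreeMagma X, (ofAlgebra k A).evalDashv a u = FreeMagma.lift a u := by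
    intro u
    induction u using FreeMagma.rec with
    | of x => rfl
    | mul u v ihu ihv => simp only [Dialgebra.evalDashv, ihu, ihv]; rfl
  induction w with
  | of x => rfl
  | right u w ih => simp only [Dimonomial.eval, hv, ih]; rfl
  | left w u ih => simp only [Dimonomial.eval, hd, ih]; rfl

theorem evalDi_ofAlgebra_psi {X : Type w} [DecidableEq X] (a : X → A) (z : X) (g : FreeAlg k X) :
    evalDi (ofAlgebra k A) a (psi z g) = FreeNonUnitalNonAssocAlgebra.lift k a g := by
  simp only [evalDi_psi, lift_eq_sum, ofAlgebra_eval, Dimonomial.word_point]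

theorem double_eval {X : Type w} [DecidableEq X] (a : X → A) (z : X) (w : Dimonomial X) :
    w.eval (double k A) (fun x => (a x, if x = z then a x else 0)) =
      (FreeMagma.lift a w.word, if w.center = z then FreeMagma.lift a w.word else 0) := by
  have hv : ∀ u : FreeMagma X, ((double k A).evalVdash
      (fun x => (a x, if x = z then a x else 0)) u).1 = FreeMagma.lift a u := by
    intro u
    induction u using FreeMagma.rec with
    | of x => rfl
    | mul u v ihu ihv => simp only [Dialgebra.evalVdash, double_vdash, ihu, ihv]; rfl
  have hd : ∀ u : FreeMagma X, ((double k A).evalDashv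
      (fun x => (a x, if x = z then a x else 0)) u).1 = FreeMagma.lift a u := by
    intro u
    induction u using FreeMagma.rec with
    | of x => rfl
    | mul u v ihu ihv => simp only [Dialgebra.evalDashv, double_dashv, ihu, ihv]; rfl
  induction w with
  | of x => rfl
  | right u w ih =>
    simp only [Dimonomial.eval, double_vdash, hv, ih, mul_ite, mul_zero]; rfl
  | left w u ih =>
    simp only [Dimonomial.eval, double_dashv, hd, ih, ite_mul, zero_mul]; rfl

/-- Evaluation in the double of `A`, with the letter `z` alone having a nonzero second component,
extracts the part of a dipolynomial with central letter `z`. -/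
theorem evalDi_double {X : Type w} [DecidableEq X] (a : X → A) (z : X) (f : FreeDialg0 k X) :
    (evalDi (double k A) (fun x => (a x, if x = z then a x else 0)) f).2 =
      FreeNonUnitalNonAssocAlgebra.lift k a (bar (centralPart z f)) := by
  induction f using Finsupp.induction_linear with
  | zero =>
    have h0 : centralPart z (0 : FreeDialg0 k X) = 0 := Finsupp.filter_zero _
    rw [h0, map_zero, map_zero, map_zero, Prod.snd_zero]
  | add f g hf hg =>
    have hfg : centralPart z (f + g) = centralPart z f + centralPart z g := Finsupp.filter_add
    rw [map_add, Prod.snd_add, hf, hg, hfg, map_add, map_add]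
  | single w c =>
    rw [← mul_one c, ← smul_eq_mul, ← Finsupp.smul_single, map_smul, evalDi_single, double_eval,
      Finsupp.smul_single, smul_eq_mul, mul_one]
    by_cases h : w.center = z
    · have hw : centralPart z (Finsupp.single w c) = Finsupp.single w c :=
        Finsupp.filter_single_of_pos _ h
      rw [hw, lift_bar, if_pos h, Prod.smul_snd]
    · have hw : centralPart z (Finsupp.single w c) = 0 := Finsupp.filter_single_of_neg _ h
      rw [hw, if_neg h, Prod.smul_snd, smul_zero, map_zero, map_zero]

end FromAlgebra

theorem double_isAssociative (k : Type u) [Field k] (A : Type v) [NonUnitalRing A] [Module k A]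
    [IsScalarTower k A A] [SMulCommClass k A A] : (double k A).IsAssociative where
  left_bar _ _ _ := rfl
  right_bar _ _ _ := rfl
  assoc_vdash _ _ _ := by simp only [double_vdash, mul_assoc]
  assoc_dashv _ _ _ := by simp only [double_dashv, mul_assoc]
  assoc_inner _ _ _ := by simp only [double_vdash, double_dashv, mul_assoc]

/-! ### Transfer of identities -/

section Transfer

variable {k : Type u} [Field k]

theorem diSJ_double {J : Type u} [NonUnitalNonAssocRing J] [Module k J] [IsScalarTower k J J]
    [SMulCommClass k J J] (hJ : SJ k J) : DiSJ k (J × J) (double k J) := by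
  obtain ⟨A, _, _, _, _, i, hi, hmul⟩ := hJ
  refine ⟨A × A, inferInstance, inferInstance, double k A, double_isAssociative k A,
    LinearMap.prodMap i i, ⟨fun p q => ?_, fun p q => ?_⟩, hi.prodMap hi⟩
  · simp [Dialgebra.plus_vdash, double_vdash, double_dashv, hmul]
  · simp [Dialgebra.plus_dashv, double_vdash, double_dashv, hmul]

theorem diJord_ofAlgebra [CharZero k] {J : Type u} [NonUnitalNonAssocRing J] [Module k J]
    [IsScalarTower k J J] [SMulCommClass k J J] (hJ : Jord k J) :
    DiJord k J (ofAlgebra k J) := by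
  refine ⟨⟨fun _ _ _ => rfl, fun _ _ _ => rfl⟩, hJ.1, fun i a => ?_⟩
  rw [evalDi_ofAlgebra_psi, lift_jordanPoly_eq_zero hJ]

/-- Identities pass to homomorphic images, so `Hom` can be dropped. -/
theorem T0_homClass (K : AlgClass k) : T0 (HomClass K) = T0 K := by
  ext g
  refine ⟨fun hg => ⟨hg.1, fun A _ _ _ _ hA a => ?_⟩, fun hg => ⟨hg.1, fun A _ _ _ _ hA a => ?_⟩⟩
  · exact hg.2 A ⟨A, _, _, _, _, hA, NonUnitalAlgHom.id k A, Function.surjective_id⟩ a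
  · obtain ⟨B, _, _, _, _, hB, φ, hφ⟩ := hA
    obtain ⟨b, rfl⟩ := hφ.comp_left a
    rw [← map_lift, hg.2 B hB, map_zero]

/-- Identities pass to homomorphic images, so `Hom` can be dropped. -/
theorem DiT0_homDialgClass (K : DialgClass k) : DiT0 (HomDialgClass K) = DiT0 K := by
  ext f
  refine ⟨fun hf => ⟨hf.1, fun D _ _ S hS a => ?_⟩, fun hf => ⟨hf.1, fun D _ _ S hS a => ?_⟩⟩
  · exact hf.2 D S ⟨D, _, _, S, hS, LinearMap.id, ⟨fun _ _ => rfl, fun _ _ => rfl⟩,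
      Function.surjective_id⟩ a
  · obtain ⟨E, _, _, T, hT, φ, hφ, hsurj⟩ := hS
    obtain ⟨b, rfl⟩ := hsurj.comp_left a
    rw [← hφ.map_evalDi, hf.2 E T hT, map_zero]

/-- Marking a letter turns identities of special Jordan algebras into identities of special Jordan
dialgebras: the algebra `E⁽⁺⁾`, for the split null extension `E` of an associative dialgebra `D`,
is special and represents `D⁽⁺⁾`. -/
theorem psi_mem_DiT0_diSJ {s : Finset ℕ} {g : FreeAlg k ℕ} (hg : IsMultilinear s g)
    (h : g ∈ T0 (SJ k)) {z : ℕ} (hz : z ∈ s) : psi z g ∈ DiT0 (DiSJ k) := by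
  refine ⟨⟨s, hg.psi z⟩, fun J _ _ S hS a => ?_⟩
  obtain ⟨D, _, _, T, hT, i, hi, hinj⟩ := hS
  apply hinj
  rw [map_zero, hi.map_evalDi]
  let _ := Dialgebra.SplitNull.nonUnitalRing hT
  have hrep := (Dialgebra.SplitNull.isSplitRep T hT.toIsZero).plus
  have hE : SJ k (Plus k (T.SplitNull hT.toIsZero)) := sj_plus
  apply ((Plus.of k _).injective.comp (Dialgebra.SplitNull.fiber_injective T hT.toIsZero))
  have h0 := hrep.lift_eq (i ∘ a) z hz hg
  rw [h.2 _ hE] at h0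
  exact h0.symm.trans (map_zero _).symm

/-- Marking a letter turns identities of Jordan algebras into identities of Jordan dialgebras. -/
theorem psi_mem_DiT0_diJord [CharZero k] {s : Finset ℕ} {g : FreeAlg k ℕ} (hg : IsMultilinear s g)
    (h : g ∈ T0 (Jord k)) {z : ℕ} (hz : z ∈ s) : psi z g ∈ DiT0 (DiJord k) := by
  refine ⟨⟨s, hg.psi z⟩, fun D _ _ S hS a => ?_⟩
  apply Dialgebra.SplitNull.fiber_injective S hS.1
  rw [← (Dialgebra.SplitNull.isSplitRep S hS.1).lift_eq a z hz hg, h.2 _ hS.jord_splitNull,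
    map_zero]

/-- Marking loses nothing on Jordan algebras: a Jordan algebra with its product taken for both
operations is a Jordan dialgebra, in which marks do not affect values. -/
theorem mem_T0_jord_of_psi_mem [CharZero k] {s : Finset ℕ} {g : FreeAlg k ℕ}
    (hg : IsMultilinear s g) {z : ℕ} (h : psi z g ∈ DiT0 (DiJord k)) : g ∈ T0 (Jord k) :=
  ⟨⟨s, hg⟩, fun A _ _ _ _ hA a => by
    rw [← evalDi_ofAlgebra_psi k a z, h.2 A _ (diJord_ofAlgebra hA)]⟩

/-- Doubling a special Jordan algebra shows that the central parts of an identity of special Jordan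
dialgebras are identities one by one. -/
theorem bar_centralPart_mem_T0_sj {s : Finset ℕ} {f : FreeDialg0 k ℕ} (hf : IsMultilinearDi s f)
    (h : f ∈ DiT0 (DiSJ k)) (z : ℕ) : bar (centralPart z f) ∈ T0 (SJ k) :=
  ⟨⟨s, (hf.centralPart z).bar⟩, fun A _ _ _ _ hA a => by
    rw [← evalDi_double, h.2 _ _ (diSJ_double hA), Prod.snd_zero]⟩

end Transfer

end JordanDialg

end

theorem mainTheorem4 {k : Type*} [Field k] [CharZero k] :
    (∀ (s : Finset ℕ) (g : JordanDialg.FreeAlg k ℕ), JordanDialg.IsMultilinear s g →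
      g ∈ JordanDialg.SId k → ∀ i ∈ s, JordanDialg.psi i g ∈ JordanDialg.DiSId k) ∧
    (∀ (s : Finset ℕ) (f : JordanDialg.FreeDialg0 k ℕ), JordanDialg.IsMultilinearDi s f →
      f ∈ JordanDialg.DiSId k →
        f = ∑ i ∈ s, JordanDialg.centralPart i f ∧
        ∃ j ∈ s, JordanDialg.bar (JordanDialg.centralPart j f) ∈ JordanDialg.SId k) := by
  simp only [JordanDialg.SId, JordanDialg.DiSId, JordanDialg.T0_homClass,
    JordanDialg.DiT0_homDialgClass]
  refine ⟨fun s g hg hgS i hi => ⟨JordanDialg.psi_mem_DiT0_diSJ hg hgS.1 hi, fun h =>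
    hgS.2 (JordanDialg.mem_T0_jord_of_psi_mem hg h)⟩, fun s f hf hfS => ?_⟩
  have hsum := JordanDialg.sum_centralPart s f hf
  refine ⟨hsum, ?_⟩
  by_contra! hcon
  refine hfS.2 ⟨⟨s, hf⟩, fun D _ _ S hS a => ?_⟩
  rw [hsum, map_sum]
  refine Finset.sum_eq_zero fun z hz => ?_
  have hz' : JordanDialg.bar (JordanDialg.centralPart z f) ∈ JordanDialg.T0 (JordanDialg.Jord k) :=
    by_contra fun h => hcon z hz ⟨JordanDialg.bar_centralPart_mem_T0_sj hf hfS.1 z, h⟩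
  rw [← JordanDialg.psi_bar_centralPart hf hz]
  exact (JordanDialg.psi_mem_DiT0_diJord (hf.centralPart z).bar hz' hz).2 D S hS a
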